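/- Let $n,m\in\mathbb N_0$, let $Y$ be a real normed space, and consider the finite-dimensional system $$\dot x = f(x,u),\qquad y = h(x),\qquad t\in[0,\infty),$$ with state space $\mathbb R^n$ and inputs $u\in\mathcal U:=L^\infty([0,\infty),\mathbb R^m)$, $\|u\|_{\mathcal U}=\operatorname{ess\,sup}_{t\ge 0}\|u(t)\|$. Here $h:\mathbb R^n\to Y$ is continuous and $f:\mathbb R^n\times\mathbb R^m\to\mathbb R^n$ is Lipschitz continuous in the first variable on bounded subsets: for every $r>0$ there is $L(r)>0$ such that $\|f(x_1,v)-f(x_2,v)\|\le L(r)\|x_1-x_2\|$ whenever $\|x_1\|,\|x_2\|,\|v\|<r$. Assume that the system is forward complete, i.e. for every $x\in\mathbb R^n$ and $u\in\mathcal U$ there is a (necessarily unique) Carathéodory solution $\phi(\cdot,x,u)$ on $[0,\infty)$ with $\phi(0,x,u)=x$: for every $t\ge 0$, the function $s\mapsto f(\phi(s,x,u),u(s))$ is integrable on $[0,t]$ and $\phi(t,x,u)=x+\int_0^t f(\phi(s,x,u),u(s))\,ds$. Put $y(t,x,u)=h(\phi(t,x,u))$. Let $\mathcal K_\infty$ be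 the set of continuous, strictly increasing, unbounded functions $\gamma:[0,\infty)\to[0,\infty)$ with $\gamma(0)=0$. Then the following are equivalent: 1. (OGULIM, output-global uniform limit property) There is $\gamma\in\mathcal K_\infty$ such that for all $\varepsilon,r>0$ there is $\tau=\tau(\varepsilon,r)\ge 0$ such that for all $x$ with $\|x\|<r$ and all $u\in\mathcal U$ there is $t\in[0,\tau]$ with $\|y(t,x,u)\|_Y\le\varepsilon+\gamma(\|u\|_{\mathcal U})$. 2. (OULIM, output-uniform limit property) There is $\gamma\in\mathcal K_\infty$ such that for all $\varepsilon,r,s>0$ there is $\tau=\tau(\varepsilon,r,s)\ge 0$ such that for all $x$ with $\|x\|<r$ and all $u\in\mathcal U$ with $\|u\|_{\mathcal U}<s$ there is $t\in[0,\tau]$ with $\|y(t,x,u)\|_Y\le\varepsilon+\gamma(\|u\|_{\mathcal U})$. 3. (OLIM, output-limit property) There is $\gamma\in\mathcal K_\infty$ such that for all $\varepsilon>0$, all $x\in\mathbb R^n$ and all $u\in\mathcal U$ there is $t\ge 0$ with $\|y(t,x,u)\|_Y\le\varepsilon+\gamma(\|u\|_{\mathcal U})$. -/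

import Mathlib

open MeasureTheory
open scoped NNReal ENNReal

/-- The comparison class `𝒦_∞`: continuous, strictly increasing, unbounded functions
`γ : [0,∞) → [0,∞)` with `γ 0 = 0`. -/
structure IsClassKInfty (γ : ℝ≥0 → ℝ≥0) : Prop where
  map_zero : γ 0 = 0
  continuous : Continuous γ
  strictMono : StrictMono γ
  unbounded : ¬ BddAbove (Set.range γ)

section LimitProperties

/-! The limit properties of a forward complete system with state space `X`, input space `𝒰` and
time set `[0,∞)`, in terms of its output trajectories `y t x u`. Only times `t ≥ 0` matter. -/

variable {X 𝒰 Y : Type*} [NormedAddCommGroup X] [NormedAddCommGroup 𝒰] [NormedAddCommGroup Y]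

/-- Output-limit property. -/
def IsOLIM (y : ℝ → X → 𝒰 → Y) : Prop :=
  ∃ γ : ℝ≥0 → ℝ≥0, IsClassKInfty γ ∧
    ∀ ε : ℝ, 0 < ε → ∀ (x : X) (u : 𝒰), ∃ t : ℝ, 0 ≤ t ∧ ‖y t x u‖ ≤ ε + (γ ‖u‖₊ : ℝ)

/-- Output-uniform limit property: the time bound depends only on `ε` and on the radii of the balls
containing the initial state and the input. -/
def IsOULIM (y : ℝ → X → 𝒰 → Y) : Prop :=
  ∃ γ : ℝ≥0 → ℝ≥0, IsClassKInfty γ ∧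
    ∀ ε r s : ℝ, 0 < ε → 0 < r → 0 < s → ∃ τ : ℝ, 0 ≤ τ ∧
      ∀ x ∈ Metric.ball (0 : X) r, ∀ u ∈ Metric.ball (0 : 𝒰) s,
        ∃ t : ℝ, 0 ≤ t ∧ t ≤ τ ∧ ‖y t x u‖ ≤ ε + (γ ‖u‖₊ : ℝ)

/-- Output-global uniform limit property: the time bound depends only on `ε` and on the radius of
the ball containing the initial state. -/
def IsOGULIM (y : ℝ → X → 𝒰 → Y) : Prop :=
  ∃ γ : ℝ≥0 → ℝ≥0, IsClassKInfty γ ∧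
    ∀ ε r : ℝ, 0 < ε → 0 < r → ∃ τ : ℝ, 0 ≤ τ ∧
      ∀ x ∈ Metric.ball (0 : X) r, ∀ u : 𝒰,
        ∃ t : ℝ, 0 ≤ t ∧ t ≤ τ ∧ ‖y t x u‖ ≤ ε + (γ ‖u‖₊ : ℝ)

end LimitProperties

/-- The space `L^∞([0,∞), ℝ^m)` of inputs, with the essential supremum norm. -/
abbrev InputSpace (m : ℕ) : Type :=
  Lp (EuclideanSpace ℝ (Fin m)) ∞ (volume.restrict (Set.Ici (0 : ℝ)))

/-- A finite-dimensional system `ẋ = f(x, u)`, `y = h(x)` with state space `ℝ^n`, input values in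
`ℝ^m` and output values in `Y`; the right-hand side `f` is Lipschitz in its first variable on
bounded subsets and the output map `h` is continuous. -/
structure ODESystem (n m : ℕ) (Y : Type*) [NormedAddCommGroup Y] where
  f : EuclideanSpace ℝ (Fin n) → EuclideanSpace ℝ (Fin m) → EuclideanSpace ℝ (Fin n)
  lipschitz : ∀ r : ℝ, 0 < r → ∃ L : ℝ, 0 < L ∧
    ∀ x₁ ∈ Metric.ball (0 : EuclideanSpace ℝ (Fin n)) r,
    ∀ x₂ ∈ Metric.ball (0 : EuclideanSpace ℝ (Fin n)) r,
    ∀ v ∈ Metric.ball (0 : EuclideanSpace ℝ (Fin m)) r,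
      ‖f x₁ v - f x₂ v‖ ≤ L * ‖x₁ - x₂‖
  h : EuclideanSpace ℝ (Fin n) → Y
  continuous_h : Continuous h

namespace ODESystem

variable {n m : ℕ} {Y : Type*} [NormedAddCommGroup Y]

/-- `ξ` is a (Carathéodory) solution on `[0,∞)` of `ξ' = f(ξ, u)`, `ξ(0) = x`, in integral form. -/
def IsSolution (S : ODESystem n m Y) (x : EuclideanSpace ℝ (Fin n)) (u : InputSpace m)
    (ξ : ℝ → EuclideanSpace ℝ (Fin n)) : Prop :=
  ∀ t : ℝ, 0 ≤ t →
    IntervalIntegrable (fun s => S.f (ξ s) (u s)) volume 0 t ∧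
    ξ t = x + ∫ s in (0 : ℝ)..t, S.f (ξ s) (u s)

/-- Forward completeness: for every initial state and every input the trajectory exists on all of
`[0,∞)`. -/
def ForwardComplete (S : ODESystem n m Y) : Prop :=
  ∀ (x : EuclideanSpace ℝ (Fin n)) (u : InputSpace m), ∃ ξ, S.IsSolution x u ξ

/-- The transition map `φ(t, x, u)` of a forward complete system. (By the Lipschitz condition the
solution is unique on `[0,∞)`; the values at negative times are irrelevant.) -/
noncomputable def transition (S : ODESystem n m Y) (hS : S.ForwardComplete)
    (t : ℝ) (x : EuclideanSpace ℝ (Fin n)) (u : InputSpace m) : EuclideanSpace ℝ (Fin n) :=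
  Classical.choose (hS x u) t

/-- The output trajectory `y(t, x, u) = h(φ(t, x, u))`. -/
noncomputable def output (S : ODESystem n m Y) (hS : S.ForwardComplete)
    (t : ℝ) (x : EuclideanSpace ℝ (Fin n)) (u : InputSpace m) : Y :=
  S.h (S.transition hS t x u)

end ODESystem

/-!
The implications from the uniform properties to the weaker ones are immediate; the content is that
the output-limit property already gives hitting times that are uniform over balls of initial states
and over all inputs.

*Uniformity over bounded inputs* (`exists_uniform_hitting_time`). The inputs are not compact in a
topology for which the flow is continuous, so one cannot pass to a limit of inputs. Instead, the
notion of an evasion limit is used (`IsEvasionLimit`): a point arbitrarily close to which there start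
solutions whose outputs stay above a level `a` for arbitrarily long times. If hitting times are
unbounded, compactness of balls in the state space gives an evasion limit `x`. Following the evading
solutions for a short time, a cluster point of their endpoints is again an evasion limit `x₁`. For a
short time the flow of any bounded input is a Lipschitz perturbation of the identity, hence open
with uniform constants; so the flow of the input of *one* evading solution close to the limit maps a
small ball around `x` over a ball around `x₁`, with outputs above `b < a`
(`IsEvasionLimit.exists_step`). Iterating gives a chain of balls, each covered by the image of the
preceding one, and by compactness an orbit through all of them (`exists_orbit_of_subset_image`). It
is the trajectory of a concatenated input. As this trajectory exists for all times, the steps cannot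
accumulate, and the output stays above `b` forever (`IsEvasionLimit.exists_forall_le`), against the
output-limit property. The initial state of the evading trajectory is only close to `x`, which is
harmless since the output-limit property is assumed for all states.

*Boundedness of `f`* (`ODESystem.ForwardComplete.exists_bound_zero`). The length of the steps depends
on a bound for `f` on bounded sets. No regularity of `f` in the input is assumed, but
forward completeness for all essentially bounded inputs implies this bound.

*All inputs* (`ODESystem.ForwardComplete.isOGULIM_of_isOLIM`). An input whose norm is at least that
of the initial state and at least `1` is dealt with at time `0`, after adding to `γ` a gain that
dominates `‖h‖` on balls of radius at least `1` (`IsClassKInfty.exists_le_and_norm_le`). The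
remaining inputs are bounded, and the interval of their norms is divided into finitely many pieces
on which `γ` is almost constant.
-/

open Set Filter Topology Metric

/-! ### Carathéodory solutions -/

section CaratheodorySolutions

variable {E F : Type*} [NormedAddCommGroup E] [NormedSpace ℝ E]

/-- `ξ` solves `ξ' = f(ξ, w)`, `ξ(0) = x` on `[0, T]` in integral form, for an input `w` that is an
honest function rather than a class of functions modulo null sets. -/
def IsCaratheodoryOn (f : E → F → E) (w : ℝ → F) (x : E) (ξ : ℝ → E) (T : ℝ) : Prop :=
  ∀ t ∈ Icc 0 T, IntervalIntegrable (fun s => f (ξ s) (w s)) volume 0 t ∧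
    ξ t = x + ∫ s in (0 : ℝ)..t, f (ξ s) (w s)

namespace IsCaratheodoryOn

variable {f : E → F → E} {w w' : ℝ → F} {x x' : E} {ξ ξ' : ℝ → E} {T : ℝ}

theorem mono (hξ : IsCaratheodoryOn f w x ξ T) {T' : ℝ} (h : T' ≤ T) :
    IsCaratheodoryOn f w x ξ T' :=
  fun t ht => hξ t ⟨ht.1, ht.2.trans h⟩

theorem apply_zero (hξ : IsCaratheodoryOn f w x ξ T) (hT : 0 ≤ T) : ξ 0 = x := by
  simpa using (hξ 0 ⟨le_rfl, hT⟩).2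

theorem continuousOn (hξ : IsCaratheodoryOn f w x ξ T) : ContinuousOn ξ (Icc 0 T) := by
  rcases lt_or_ge T 0 with hT | hT
  · simp [Icc_eq_empty_of_lt hT]
  have h := intervalIntegral.continuousOn_primitive_interval (a := 0) (b := T) (μ := volume)
    (f := fun s => f (ξ s) (w s)) (by
      exact (intervalIntegrable_iff' (by finiteness)).1 (hξ T ⟨hT, le_rfl⟩).1)
  rw [uIcc_of_le hT] at h
  exact (continuousOn_const.add h).congr fun t ht => (hξ t ht).2

theorem congr_input (hξ : IsCaratheodoryOn f w x ξ T)
    (h : ∀ᵐ s, s ∈ Ioc 0 T → w s = w' s) : IsCaratheodoryOn f w' x ξ T := by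
  intro t ht
  have hae : ∀ᵐ s, s ∈ uIoc 0 t → f (ξ s) (w s) = f (ξ s) (w' s) := by
    filter_upwards [h] with s hs hst
    rw [uIoc_of_le ht.1] at hst
    rw [hs ⟨hst.1, hst.2.trans ht.2⟩]
  refine ⟨(hξ t ht).1.congr_ae ?_, ?_⟩
  · exact (ae_restrict_iff' measurableSet_uIoc).2 hae
  · rw [← intervalIntegral.integral_congr_ae hae]
    exact (hξ t ht).2

theorem shift (hξ : IsCaratheodoryOn f w x ξ T) {a b : ℝ} (ha : 0 ≤ a) (hab : a + b ≤ T) :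
    IsCaratheodoryOn f (fun s => w (a + s)) (ξ a) (fun s => ξ (a + s)) b := by
  intro t ht
  obtain ⟨hi, he⟩ := hξ (a + t) ⟨by linarith [ht.1], by linarith [ht.2]⟩
  obtain ⟨hi', he'⟩ := hξ a ⟨ha, by linarith [ht.1, ht.2]⟩
  have hi2 : IntervalIntegrable (fun s => f (ξ s) (w s)) volume a (a + t) := hi'.symm.trans hi
  refine ⟨?_, ?_⟩
  · simpa using hi2.comp_add_left (c := a)
  · change ξ (a + t) = _
    rw [intervalIntegral.integral_comp_add_left (fun s => f (ξ s) (w s)) a, add_zero, he,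
      ← intervalIntegral.integral_add_adjacent_intervals hi' hi2, ← add_assoc, ← he']

variable [NormedAddCommGroup F]

/-- On a time interval too short for the maximal speed `M` to carry it over a distance `1`, a
solution stays within distance `1` of its initial ball. -/
theorem norm_le (hξ : IsCaratheodoryOn f w x ξ T) {R c M : ℝ}
    (hM : ∀ z v, ‖z‖ ≤ R + 1 → ‖v‖ ≤ c → ‖f z v‖ ≤ M) (hw : ∀ s, ‖w s‖ ≤ c)
    (hx : ‖x‖ ≤ R) (hT : M * T < 1) {t : ℝ} (ht : t ∈ Icc 0 T) : ‖ξ t‖ ≤ R + 1 := by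
  have hM0 : 0 ≤ M := (norm_nonneg _).trans
    (hM 0 (w 0) (by simpa using by linarith [norm_nonneg x]) (hw 0))
  have key : ∀ t ∈ Icc 0 T, ‖ξ t - x‖ < 1 := by
    by_contra! hcon
    obtain ⟨t₁, ht₁, ht₁'⟩ := hcon
    have hK : IsCompact (Icc 0 T ∩ (fun t => ‖ξ t - x‖) ⁻¹' Ici 1) :=
      isCompact_Icc.of_isClosed_subset
        ((hξ.continuousOn.sub continuousOn_const).norm.preimage_isClosed_of_isClosed
          isClosed_Icc isClosed_Ici) inter_subset_left
    -- the first time at which the distance `1` is reached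
    obtain ⟨t₀, ⟨ht₀, hd⟩, hmin⟩ := hK.exists_isLeast ⟨t₁, ht₁, ht₁'⟩
    have hbound : ‖∫ s in (0 : ℝ)..t₀, f (ξ s) (w s)‖ ≤ M * |t₀ - 0| := by
      refine intervalIntegral.norm_integral_le_of_norm_le_const_ae ?_
      filter_upwards [Measure.ae_ne volume t₀] with s hs hs'
      rw [uIoc_of_le ht₀.1] at hs'
      have hlt : s < t₀ := lt_of_le_of_ne hs'.2 hs
      have hlt1 : ‖ξ s - x‖ < 1 := by
        by_contra! h
        exact absurd (hmin ⟨⟨hs'.1.le, hs'.2.trans ht₀.2⟩, h⟩) (not_le.2 hlt)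
      refine hM _ _ ?_ (hw s)
      calc ‖ξ s‖ = ‖x + (ξ s - x)‖ := by congr 1; abel
        _ ≤ ‖x‖ + ‖ξ s - x‖ := norm_add_le _ _
        _ ≤ R + 1 := by linarith
    rw [sub_zero, abs_of_nonneg ht₀.1] at hbound
    have hd' : (1 : ℝ) ≤ ‖ξ t₀ - x‖ := hd
    rw [(hξ t₀ ht₀).2, add_sub_cancel_left] at hd'
    nlinarith [mul_le_mul_of_nonneg_left ht₀.2 hM0]
  calc ‖ξ t‖ = ‖x + (ξ t - x)‖ := by congr 1; abel
    _ ≤ ‖x‖ + ‖ξ t - x‖ := norm_add_le _ _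
    _ ≤ R + 1 := by linarith [key t ht]

/-- Over a time `T` with `L * T ≤ 1 / 3`, two solutions with the same input differ by their initial
difference up to a relative error of `1 / 2`. This is a Grönwall estimate, uniform in the input; it
also contains uniqueness on `[0, T]`. -/
theorem norm_sub_sub_le (hξ : IsCaratheodoryOn f w x ξ T) (hξ' : IsCaratheodoryOn f w x' ξ' T)
    {R c L : ℝ} (hL : 0 ≤ L)
    (hf : ∀ z z' v, ‖z‖ ≤ R → ‖z'‖ ≤ R → ‖v‖ ≤ c → ‖f z v - f z' v‖ ≤ L * ‖z - z'‖)
    (hw : ∀ s, ‖w s‖ ≤ c) (hR : ∀ t ∈ Icc 0 T, ‖ξ t‖ ≤ R) (hR' : ∀ t ∈ Icc 0 T, ‖ξ' t‖ ≤ R)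
    (hT : L * T ≤ 1 / 3) {t : ℝ} (ht : t ∈ Icc 0 T) :
    ‖(ξ t - ξ' t) - (x - x')‖ ≤ 1 / 2 * ‖x - x'‖ := by
  obtain ⟨t₀, ht₀, hmax⟩ := isCompact_Icc.exists_isMaxOn ⟨t, ht⟩
    (hξ.continuousOn.sub hξ'.continuousOn).norm
  set D := ‖ξ t₀ - ξ' t₀‖ with hD
  have key : ∀ t ∈ Icc 0 T, ‖(ξ t - ξ' t) - (x - x')‖ ≤ 1 / 3 * D := by
    intro t ht
    have hsub : (ξ t - ξ' t) - (x - x') =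
        ∫ s in (0 : ℝ)..t, (f (ξ s) (w s) - f (ξ' s) (w s)) := by
      rw [intervalIntegral.integral_sub (hξ t ht).1 (hξ' t ht).1, (hξ t ht).2, (hξ' t ht).2]
      abel
    have hb : ‖∫ s in (0 : ℝ)..t, (f (ξ s) (w s) - f (ξ' s) (w s))‖ ≤ L * D * |t - 0| := by
      refine intervalIntegral.norm_integral_le_of_norm_le_const fun s hs => ?_
      rw [uIoc_of_le ht.1] at hs
      have hsT : s ∈ Icc 0 T := ⟨hs.1.le, hs.2.trans ht.2⟩
      exact (hf _ _ _ (hR s hsT) (hR' s hsT) (hw s)).trans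
        (mul_le_mul_of_nonneg_left (hmax hsT) hL)
    rw [sub_zero, abs_of_nonneg ht.1] at hb
    rw [hsub]
    have h1 : L * t ≤ 1 / 3 := (mul_le_mul_of_nonneg_left ht.2 hL).trans hT
    nlinarith [mul_le_mul_of_nonneg_right h1 (norm_nonneg (ξ t₀ - ξ' t₀))]
  have hD' : D ≤ ‖x - x'‖ + 1 / 3 * D := by
    calc D = ‖(x - x') + ((ξ t₀ - ξ' t₀) - (x - x'))‖ := by rw [hD]; congr 1; abel
      _ ≤ ‖x - x'‖ + ‖(ξ t₀ - ξ' t₀) - (x - x')‖ := norm_add_le _ _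
      _ ≤ _ := by linarith [key t₀ ht₀]
  linarith [key t ht]

end IsCaratheodoryOn

end CaratheodorySolutions

/-! ### Orbits through a chain of compact sets -/

/-- An inverse limit of nonempty compact sets is nonempty: if each map `G i` covers `B (i + 1)` from
`B i`, then some orbit visits all the sets `B i`. -/
theorem exists_orbit_of_subset_image {E : Type*} [TopologicalSpace E] [T2Space E] {B : ℕ → Set E}
    {G : ℕ → E → E} (hB : ∀ i, IsCompact (B i)) (hne : ∀ i, (B i).Nonempty)
    (hG : ∀ i, ContinuousOn (G i) (B i)) (himg : ∀ i, B (i + 1) ⊆ G i '' B i) :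
    ∃ z : ℕ → E, ∀ i, z i ∈ B i ∧ z (i + 1) = G i (z i) := by
  -- `D j i` consists of the points of `B i` whose next `j` iterates visit the next `j` sets
  let D : ℕ → ℕ → Set E := fun j =>
    Nat.rec (fun i => B i) (fun _ A i => B i ∩ G i ⁻¹' A (i + 1)) j
  have hsucc : ∀ j i, D (j + 1) i = B i ∩ G i ⁻¹' D j (i + 1) := fun _ _ => rfl
  have hsub : ∀ j i, D j i ⊆ B i := by
    rintro (_ | j) i
    · exact subset_rfl
    · exact inter_subset_left
  have hcl : ∀ j i, IsClosed (D j i) := by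
    intro j
    induction j with
    | zero => exact fun i => (hB i).isClosed
    | succ j ih => exact fun i => (hG i).preimage_isClosed_of_isClosed (hB i).isClosed (ih _)
  have hDne : ∀ j i, (D j i).Nonempty := by
    intro j
    induction j with
    | zero => exact hne
    | succ j ih =>
      intro i
      obtain ⟨y, hy⟩ := ih (i + 1)
      obtain ⟨x, hx, rfl⟩ := himg i (hsub j _ hy)
      exact ⟨x, hx, hy⟩
  have hanti : ∀ j i, D (j + 1) i ⊆ D j i := by
    intro j
    induction j with
    | zero => exact fun i => inter_subset_left
    | succ j ih => exact fun i => inter_subset_inter_right _ (preimage_mono (ih _))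
  obtain ⟨z₀, hz₀⟩ := IsCompact.nonempty_iInter_of_sequence_nonempty_isCompact_isClosed
    (fun j => D j 0) (fun j => hanti j 0) (fun j => hDne j 0) (hB 0) (fun j => hcl j 0)
  let z : ℕ → E := fun i => Nat.rec z₀ (fun i y => G i y) i
  have hz : ∀ i j, z i ∈ D j i := by
    intro i
    induction i with
    | zero => exact fun j => mem_iInter.1 hz₀ j
    | succ i ih => exact fun j => (ih (j + 1)).2
  exact ⟨z, fun i => ⟨hz i 0, rfl⟩⟩

/-! ### Evasion limits and the short-time flow -/

section Shadowing

variable {E F Y : Type*} [NormedAddCommGroup E] [NormedSpace ℝ E] [NormedAddCommGroup F]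
  [MeasurableSpace F] [NormedAddCommGroup Y]

/-- The points that are limits of initial states of solutions, with inputs bounded by `c`, whose
output stays above `a` on arbitrarily long time intervals. The solutions are only required to exist
on these intervals, so that no uniqueness is needed to restart one of them at a later time. -/
def IsEvasionLimit (f : E → F → E) (h : E → Y) (c a : ℝ) (x : E) : Prop :=
  ∀ δ > 0, ∀ T : ℝ, ∃ x' ∈ ball x δ, ∃ w : ℝ → F, Measurable w ∧ (∀ s, ‖w s‖ ≤ c) ∧
    ∃ ξ, IsCaratheodoryOn f w x' ξ T ∧ ∀ t ∈ Icc 0 T, a ≤ ‖h (ξ t)‖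

/-- `H` is so short a time that, for all inputs bounded by `c`, solutions from the ball of radius
`R` do not leave the ball of radius `R + 1` within `[0, H]`, and the flow on `[0, H]` is a Lipschitz
perturbation of the identity with constant `1 / 2`. -/
structure IsStepTime (f : E → F → E) (c R H : ℝ) : Prop where
  pos : 0 < H
  norm_le : ∀ {w x ξ}, (∀ s, ‖w s‖ ≤ c) → ‖x‖ ≤ R → IsCaratheodoryOn f w x ξ H →
    ∀ t ∈ Icc 0 H, ‖ξ t‖ ≤ R + 1
  norm_sub_sub_le : ∀ {w x x' ξ ξ'}, (∀ s, ‖w s‖ ≤ c) → ‖x‖ ≤ R → ‖x'‖ ≤ R →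
    IsCaratheodoryOn f w x ξ H → IsCaratheodoryOn f w x' ξ' H →
    ∀ t ∈ Icc 0 H, ‖(ξ t - ξ' t) - (x - x')‖ ≤ 1 / 2 * ‖x - x'‖

omit [MeasurableSpace F] in
theorem exists_isStepTime {f : E → F → E} {c R M L : ℝ}
    (hM : ∀ z v, ‖z‖ ≤ R + 1 → ‖v‖ ≤ c → ‖f z v‖ ≤ M) (hL : 0 ≤ L)
    (hf : ∀ z z' v, ‖z‖ ≤ R + 1 → ‖z'‖ ≤ R + 1 → ‖v‖ ≤ c → ‖f z v - f z' v‖ ≤ L * ‖z - z'‖) :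
    ∃ H, IsStepTime f c R H := by
  have hpos : 0 < 3 * (L + |M| + 1) := by positivity
  have hMT : M * (1 / (3 * (L + |M| + 1))) < 1 := by
    rw [mul_one_div, div_lt_one hpos]
    linarith [le_abs_self M, abs_nonneg M]
  have hLT : L * (1 / (3 * (L + |M| + 1))) ≤ 1 / 3 := by
    rw [mul_one_div, div_le_iff₀ hpos]
    linarith [abs_nonneg M]
  have hle : ∀ {w x ξ}, (∀ s, ‖w s‖ ≤ c) → ‖x‖ ≤ R →
      IsCaratheodoryOn f w x ξ (1 / (3 * (L + |M| + 1))) →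
      ∀ t ∈ Icc 0 (1 / (3 * (L + |M| + 1))), ‖ξ t‖ ≤ R + 1 :=
    fun hw hx hξ t ht => hξ.norm_le hM hw hx hMT ht
  exact ⟨1 / (3 * (L + |M| + 1)), by positivity, hle, fun hw hx hx' hξ hξ' t ht =>
    hξ.norm_sub_sub_le hξ' hL hf hw (hle hw hx hξ) (hle hw hx' hξ') hLT ht⟩

/-- One step of the construction of an evading trajectory. From an evasion limit `x` a short step
leads to another evasion limit `x₁`, in such a way that the flow `G` of a single input `w` maps a
small ball around `x` over a smaller ball around `x₁`, with outputs above `b < a` on the way. The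
point `x₁` is a limit of the endpoints of evading trajectories, and `w` is the input of one of
them. -/
theorem IsEvasionLimit.exists_step [ProperSpace E] {f : E → F → E} {h : E → Y} {c a b R H : ℝ}
    {x : E} (hx : IsEvasionLimit f h c a x) (hh : Continuous h) (hH : IsStepTime f c (R + 1) H)
    (hfc : ∀ x w, Measurable w → (∀ s, ‖w s‖ ≤ c) → ∃ ξ, ∀ T, IsCaratheodoryOn f w x ξ T)
    (hba : b < a) (hxR : ‖x‖ ≤ R) {δ : ℝ} (hδ : 0 < δ) :
    ∃ δ' w G x₁ δ₁, 0 < δ' ∧ δ' ≤ δ ∧ δ' ≤ 1 ∧ Measurable w ∧ (∀ s, ‖w s‖ ≤ c) ∧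
      ContinuousOn G (closedBall x δ') ∧ 0 < δ₁ ∧ IsEvasionLimit f h c a x₁ ∧
      closedBall x₁ δ₁ ⊆ G '' closedBall x δ' ∧
      ∀ z ∈ closedBall x δ', ∀ ξ, IsCaratheodoryOn f w z ξ H →
        ξ H = G z ∧ ∀ t ∈ Icc 0 H, b ≤ ‖h (ξ t)‖ := by
  have hH0 : H ∈ Icc 0 H := ⟨hH.pos.le, le_rfl⟩
  obtain ⟨η, hη, hηh⟩ := Metric.uniformContinuousOn_iff.1
    ((isCompact_closedBall (0 : E) (R + 1 + 1)).uniformContinuousOn_of_continuous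
      hh.continuousOn) (a - b) (sub_pos.2 hba)
  -- `δ' ≤ η / 4` because trajectories from the ball of radius `δ'` around `x` stay within distance
  -- `(3 / 2) * (3 / 2) * δ'` of the evading trajectory, which starts within `δ' / 2` of `x`
  obtain ⟨δ', hδ'0, hδ'⟩ : ∃ δ' > 0, δ' ≤ min (min δ 1) (η / 4) :=
    ⟨_, lt_min (lt_min hδ one_pos) (by positivity), le_rfl⟩
  rw [le_min_iff, le_min_iff] at hδ'
  obtain ⟨⟨hδ'δ, hδ'1⟩, hδ'η⟩ := hδ'
  have hball : ∀ z ∈ closedBall x δ', ‖z‖ ≤ R + 1 := fun z hz => by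
    have h1 : ‖z - x‖ ≤ δ' := by simpa [dist_eq_norm] using hz
    linarith [norm_le_norm_add_norm_sub' z x]
  choose X hX W hWm hWc Ξ hΞ hΞh using fun k : ℕ => hx (δ' / 2) (half_pos hδ'0) (k + H)
  have hXδ : ∀ k, X k ∈ closedBall x δ' := fun k =>
    closedBall_subset_closedBall (by linarith) (ball_subset_closedBall (hX k))
  have hkH : ∀ k : ℕ, H ≤ k + H := fun k => by linarith [(Nat.cast_nonneg k : (0 : ℝ) ≤ k)]
  obtain ⟨x₁, -, φ, hφ, hlim⟩ := (isCompact_closedBall (0 : E) (R + 1 + 1)).tendsto_subseq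
    (x := fun k => Ξ k H) fun k => by
      simpa using hH.norm_le (hWc k) (hball _ (hXδ k)) ((hΞ k).mono (hkH k)) H hH0
  have hx₁ : IsEvasionLimit f h c a x₁ := by
    intro ρ hρ T
    obtain ⟨k, hk, hkT⟩ := ((hlim.eventually (ball_mem_nhds x₁ hρ)).and
      ((tendsto_natCast_atTop_atTop.comp hφ.tendsto_atTop).eventually_ge_atTop T)).exists
    have hkT' : H + T ≤ (φ k : ℝ) + H := by
      have : T ≤ (φ k : ℝ) := hkT
      linarith
    refine ⟨Ξ (φ k) H, hk, _, (hWm (φ k)).comp (measurable_const_add H), fun s => hWc _ _, _,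
      (hΞ (φ k)).shift hH.pos.le hkT', fun t ht => hΞh (φ k) _ ⟨?_, ?_⟩⟩
    · linarith [ht.1, hH.pos]
    · linarith [ht.2]
  obtain ⟨k, hk⟩ := (hlim.eventually (ball_mem_nhds x₁ (by positivity : 0 < δ' / 8))).exists
  set j := φ k
  choose Φ hΦ using fun z => hfc z (W j) (hWm j) (hWc j)
  have happrox : ApproximatesLinearOn (fun z => Φ z H)
      ((ContinuousLinearEquiv.refl ℝ E : E ≃L[ℝ] E) : E →L[ℝ] E) (closedBall x δ') (1 / 2) := by
    intro z hz z' hz'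
    have := hH.norm_sub_sub_le (hWc j) (hball z hz) (hball z' hz') (hΦ z H) (hΦ z' H) H hH0
    simpa using this
  have huniq : ∀ z ∈ closedBall x δ', ∀ ξ, IsCaratheodoryOn f (W j) z ξ H → ξ H = Φ z H := by
    intro z hz ξ hξ
    have := hH.norm_sub_sub_le (hWc j) (hball z hz) (hball z hz) hξ (hΦ z H) H hH0
    simpa [sub_eq_zero] using this
  refine ⟨δ', W j, fun z => Φ z H, x₁, δ' / 8, hδ'0, hδ'δ, hδ'1, hWm j, hWc j,
    happrox.continuousOn, by positivity, hx₁, ?_, fun z hz ξ hξ => ⟨huniq z hz ξ hξ, ?_⟩⟩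
  · have hXsub : closedBall (X j) (δ' / 2) ⊆ closedBall x δ' :=
      closedBall_subset_closedBall' (by
        have : dist (X j) x < δ' / 2 := hX j
        linarith)
    -- the identity is a right inverse of norm at most `1`, so the image of the ball of radius
    -- `δ' / 2` contains a ball of radius `(1 - 1 / 2) * (δ' / 2) = δ' / 8 + δ' / 8`
    have hsurj := happrox.surjOn_closedBall_of_nonlinearRightInverse
      ⟨id, 1, fun y => by simp, fun y => rfl⟩ (by positivity) hXsub
    refine Subset.trans (closedBall_subset_closedBall' ?_)
      (Subset.trans hsurj (image_mono hXsub))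
    have hk' : dist (Ξ j H) x₁ < δ' / 8 := hk
    rw [dist_comm, ← huniq _ (hXδ j) _ ((hΞ j).mono (hkH j))]
    norm_num
    linarith
  · intro t ht
    have hd := hH.norm_sub_sub_le (hWc j) (hball z hz) (hball _ (hXδ j)) hξ
      ((hΞ j).mono (hkH j)) t ht
    have hzX : ‖z - X j‖ ≤ δ' + δ' / 2 := by
      have h1 : dist z x ≤ δ' := hz
      have h2 : dist (X j) x < δ' / 2 := hX j
      rw [← dist_eq_norm]
      linarith [dist_triangle_right z (X j) x]
    have hclose : dist (ξ t) (Ξ j t) < η := by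
      rw [dist_eq_norm]
      have := norm_le_norm_add_norm_sub' (ξ t - Ξ j t) (z - X j)
      linarith
    have hout := hηh (ξ t)
      (by simpa using hH.norm_le (hWc j) (hball z hz) hξ t ht) (Ξ j t)
      (by simpa using hH.norm_le (hWc j) (hball _ (hXδ j)) ((hΞ j).mono (hkH j)) t ht) hclose
    have ha := hΞh j t ⟨ht.1, ht.2.trans (hkH j)⟩
    rw [dist_eq_norm] at hout
    linarith [norm_le_norm_add_norm_sub (h (ξ t)) (h (Ξ j t))]

end Shadowing

/-! ### Construction of an evading trajectory -/

theorem Measurable.exists_norm_le_eq {α F : Type*} [MeasurableSpace α] [NormedAddCommGroup F]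
    [MeasurableSpace F] [OpensMeasurableSpace F] {g : α → F} (hg : Measurable g) {c : ℝ}
    (hc : 0 ≤ c) :
    ∃ w : α → F, Measurable w ∧ (∀ s, ‖w s‖ ≤ c) ∧ ∀ s, ‖g s‖ ≤ c → w s = g s := by
  classical
  refine ⟨fun s => if ‖g s‖ ≤ c then g s else 0,
    Measurable.ite (measurableSet_le hg.norm measurable_const) hg measurable_const,
    fun s => ?_, fun s hs => if_pos hs⟩
  by_cases h : ‖g s‖ ≤ c <;> simp [h, hc]

theorem exists_pos_le_of_forall_pos {H : ℕ → ℝ} (hH : ∀ k, 0 < H k) (N : ℕ) :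
    ∃ η > 0, ∀ k ≤ N, η ≤ H k := by
  obtain ⟨k, -, hk⟩ := (Finset.range (N + 1)).exists_min_image H ⟨0, by simp⟩
  exact ⟨H k, hH k, fun j hj => hk j (by simpa [Nat.lt_succ_iff] using hj)⟩

section Shadowing

variable {E F Y : Type*} [NormedAddCommGroup E] [NormedSpace ℝ E] [ProperSpace E]
  [NormedAddCommGroup F] [MeasurableSpace F] [OpensMeasurableSpace F] [NormedAddCommGroup Y]

/-- From an evasion limit one obtains a single initial state and a single input whose trajectory
evades forever. The steps of `IsEvasionLimit.exists_step` yield a chain of balls, each covered by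
the flow of the preceding one, hence an orbit through all of them, and the inputs of the steps are
concatenated. The trajectory of the concatenated input exists for all times and is therefore
bounded on bounded time intervals; so the lengths of the steps are bounded below there, and the
steps exhaust `[0, ∞)`. -/
theorem IsEvasionLimit.exists_forall_le {f : E → F → E} {h : E → Y} {c a b : ℝ} {x : E}
    (hx : IsEvasionLimit f h c a x) (hh : Continuous h) (hstep : ∀ R, ∃ H, IsStepTime f c R H)
    (hfc : ∀ x w, Measurable w → (∀ s, ‖w s‖ ≤ c) → ∃ ξ, ∀ T, IsCaratheodoryOn f w x ξ T)
    (hba : b < a) :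
    ∃ z w, Measurable w ∧ (∀ s, ‖w s‖ ≤ c) ∧
      ∀ ζ, (∀ T, IsCaratheodoryOn f w z ζ T) → ∀ t, 0 ≤ t → b ≤ ‖h (ζ t)‖ := by
  choose H hH using fun N : ℕ => hstep (N + 1)
  choose δ' w G x₁ δ₁ hδ'0 hδ'le hδ'1 hwm hwc hG hδ₁ hx₁ himg hout using
    fun q : {p : E × ℝ // IsEvasionLimit f h c a p.1 ∧ 0 < p.2} =>
      q.2.1.exists_step hh (hH ⌈‖q.1.1‖⌉₊) hfc hba (Nat.le_ceil _) q.2.2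
  let p : ℕ → {p : E × ℝ // IsEvasionLimit f h c a p.1 ∧ 0 < p.2} := fun i =>
    Nat.rec ⟨(x, 1), hx, one_pos⟩ (fun _ q => ⟨(x₁ q, δ₁ q), hx₁ q, hδ₁ q⟩) i
  have hc : 0 ≤ c := (norm_nonneg _).trans (hwc (p 0) 0)
  have himg' : ∀ i, closedBall (p (i + 1)).1.1 (δ' (p (i + 1))) ⊆
      G (p i) '' closedBall (p i).1.1 (δ' (p i)) := fun i => by
    refine Subset.trans (closedBall_subset_closedBall ?_) (himg (p i))
    exact hδ'le (p (i + 1))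
  obtain ⟨z, hz⟩ := exists_orbit_of_subset_image (fun i => isCompact_closedBall _ _)
    (fun i => nonempty_closedBall.2 (hδ'0 (p i)).le) (fun i => hG (p i)) himg'
  -- the step lengths, the starting times of the steps, and the concatenated input
  let σ : ℕ → ℝ := fun i => H ⌈‖(p i).1.1‖⌉₊
  let τ : ℕ → ℝ := fun i => ∑ j ∈ Finset.range i, σ j
  have hσ : ∀ i, 0 < σ i := fun i => (hH _).pos
  have hτs : ∀ i, τ (i + 1) = τ i + σ i := fun i => Finset.sum_range_succ _ _
  have hτm : Monotone τ := monotone_nat_of_le_succ fun i => by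
    rw [hτs]; linarith [hσ i]
  have hτ0 : ∀ i, 0 ≤ τ i := fun i => Finset.sum_nonneg fun j _ => (hσ j).le
  obtain ⟨g, hgm, hg⟩ := exists_measurable_piecewise (fun i => Ico (τ i) (τ (i + 1)))
    (fun i => measurableSet_Ico) (fun i s => w (p i) (s - τ i))
    (fun i => (hwm (p i)).comp (measurable_id.sub_const _)) (fun i j hij s hs =>
      ((hτm.pairwise_disjoint_on_Ico_succ hij).le_bot hs).elim)
  obtain ⟨W, hWm, hWc, hW⟩ := hgm.exists_norm_le_eq hc
  have hWeq : ∀ i, ∀ s ∈ Ico 0 (σ i), W (τ i + s) = w (p i) s := fun i s hs => by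
    have h1 : g (τ i + s) = w (p i) s := by
      simpa using hg i (x := τ i + s) ⟨by linarith [hs.1], by rw [hτs]; linarith [hs.2]⟩
    rw [hW _ (by rw [h1]; exact hwc _ _), h1]
  refine ⟨z 0, W, hWm, hWc, fun ζ hζ => ?_⟩
  have hstepζ : ∀ i, ζ (τ i) = z i →
      IsCaratheodoryOn f (w (p i)) (z i) (fun s => ζ (τ i + s)) (σ i) := fun i hi => by
    rw [← hi]
    refine ((hζ (τ i + σ i)).shift (hτ0 i) le_rfl).congr_input ?_
    filter_upwards [Measure.ae_ne volume (σ i)] with s hs hs'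
    exact hWeq i s ⟨hs'.1.le, lt_of_le_of_ne hs'.2 hs⟩
  have hζz : ∀ i, ζ (τ i) = z i := by
    intro i
    induction i with
    | zero => simpa [τ] using (hζ 0).apply_zero le_rfl
    | succ i ih =>
      rw [hτs, (hz i).2]
      exact (hout (p i) (z i) (hz i).1 _ (hstepζ i ih)).1
  have hunb : ∀ t, ∃ i, t < τ i := by
    by_contra! hcon
    obtain ⟨T, hT⟩ := hcon
    obtain ⟨C, hC⟩ := isCompact_Icc.exists_bound_of_continuousOn (hζ T).continuousOn
    have hpC : ∀ i, ‖(p i).1.1‖ ≤ C + 1 := fun i => by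
      have h1 := hC (τ i) ⟨hτ0 i, hT i⟩
      rw [hζz i] at h1
      have h2 : ‖z i - (p i).1.1‖ ≤ δ' (p i) := by simpa [dist_eq_norm] using (hz i).1
      linarith [hδ'1 (p i), norm_le_norm_add_norm_sub (z i) (p i).1.1]
    obtain ⟨η, hη, hηH⟩ := exists_pos_le_of_forall_pos (fun k => (hH k).pos) ⌈C + 1⌉₊
    obtain ⟨i, hi⟩ := exists_nat_gt (T / η)
    have h1 : i • η ≤ τ i := by
      simpa using Finset.card_nsmul_le_sum (Finset.range i) σ η
        fun j _ => hηH _ (Nat.ceil_mono (hpC j))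
    rw [div_lt_iff₀ hη] at hi
    rw [nsmul_eq_mul] at h1
    linarith [hT i]
  intro t ht
  classical
  -- the step during which the time `t` is reached
  obtain ⟨i, hi, hmin⟩ : ∃ i, t < τ (i + 1) ∧ τ i ≤ t := by
    have hpos : Nat.find (hunb t) ≠ 0 := fun h0 => by
      have := Nat.find_spec (hunb t)
      rw [h0] at this
      simp [τ] at this
      linarith
    obtain ⟨i, hi⟩ := Nat.exists_eq_succ_of_ne_zero hpos
    refine ⟨i, ?_, not_lt.1 (Nat.find_min (hunb t) (by omega))⟩
    have := Nat.find_spec (hunb t)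
    rwa [hi] at this
  have := (hout (p i) (z i) (hz i).1 _ (hstepζ i (hζz i))).2 (t - τ i)
    ⟨by linarith, by have := hτs i; change t - τ i ≤ σ i; linarith⟩
  simpa using this

/-- Uniform hitting times: if every trajectory with input bounded by `c` has an output of norm at
most `a'` at some time, then, for `a > a'`, the time needed to reach an output of norm at most `a`
is bounded uniformly over all initial states in a ball and all inputs bounded by `c`. -/
theorem exists_uniform_hitting_time {f : E → F → E} {h : E → Y} {c a a' : ℝ} (hh : Continuous h)
    (hstep : ∀ R, ∃ H, IsStepTime f c R H)
    (hfc : ∀ x w, Measurable w → (∀ s, ‖w s‖ ≤ c) → ∃ ξ, ∀ T, IsCaratheodoryOn f w x ξ T)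
    (ha : a' < a)
    (hhit : ∀ x w, Measurable w → (∀ s, ‖w s‖ ≤ c) →
      ∃ ξ, (∀ T, IsCaratheodoryOn f w x ξ T) ∧ ∃ t, 0 ≤ t ∧ ‖h (ξ t)‖ ≤ a') (r : ℝ) :
    ∃ τ : ℝ, 0 ≤ τ ∧ ∀ x ∈ ball (0 : E) r, ∀ w, Measurable w → (∀ s, ‖w s‖ ≤ c) →
      ∀ ξ, (∀ T, IsCaratheodoryOn f w x ξ T) → ∃ t, 0 ≤ t ∧ t ≤ τ ∧ ‖h (ξ t)‖ ≤ a := by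
  by_contra! hcon
  choose X hX W hWm hWc Ξ hΞ hΞh using fun k : ℕ => hcon k k.cast_nonneg
  obtain ⟨x, -, φ, hφ, hlim⟩ := (isCompact_closedBall (0 : E) r).tendsto_subseq
    (x := X) fun k => ball_subset_closedBall (hX k)
  have hx : IsEvasionLimit f h c a x := by
    intro δ hδ T
    obtain ⟨k, hk, hkT⟩ := ((hlim.eventually (ball_mem_nhds x hδ)).and
      ((tendsto_natCast_atTop_atTop.comp hφ.tendsto_atTop).eventually_ge_atTop T)).exists
    exact ⟨_, hk, _, hWm _, hWc _, _, hΞ _ T, fun t ht =>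
      (hΞh _ t ht.1 (ht.2.trans hkT)).le⟩
  obtain ⟨b, hb, hba⟩ := exists_between ha
  obtain ⟨z, w, hwm, hwc, hz⟩ := hx.exists_forall_le hh hstep hfc hba
  obtain ⟨ξ, hξ, t, ht, hle⟩ := hhit z w hwm hwc
  linarith [hz ξ hξ t ht]

end Shadowing

/-! ### Inputs as bounded measurable functions -/

section Inputs

theorem InputSpace.ae_norm_le {m : ℕ} (u : InputSpace m) :
    ∀ᵐ s ∂volume.restrict (Ici (0 : ℝ)), ‖u s‖ ≤ ‖u‖ := by
  filter_upwards [ae_le_eLpNormEssSup (f := u) (μ := volume.restrict (Ici (0 : ℝ)))] with s hs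
  rw [Lp.norm_def, eLpNorm_exponent_top, ← toReal_enorm]
  refine ENNReal.toReal_mono ?_ hs
  rw [← eLpNorm_exponent_top]
  exact (Lp.memLp u).2.ne

theorem InputSpace.exists_measurable_representative {m : ℕ} (u : InputSpace m) :
    ∃ w : ℝ → EuclideanSpace ℝ (Fin m), Measurable w ∧ (∀ s, ‖w s‖ ≤ ‖u‖) ∧
      u =ᵐ[volume.restrict (Ici (0 : ℝ))] w := by
  obtain ⟨w, hwm, hwc, hw⟩ :=
    (Lp.stronglyMeasurable u).measurable.exists_norm_le_eq (norm_nonneg u)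
  refine ⟨w, hwm, hwc, ?_⟩
  filter_upwards [InputSpace.ae_norm_le u] with s hs using (hw s hs).symm

theorem exists_inputSpace_of_norm_le {m : ℕ} {w : ℝ → EuclideanSpace ℝ (Fin m)}
    (hw : Measurable w) {c : ℝ} (hc : ∀ s, ‖w s‖ ≤ c) :
    ∃ u : InputSpace m, ‖u‖ ≤ c ∧ u =ᵐ[volume.restrict (Ici (0 : ℝ))] w := by
  have hmem : MemLp w ∞ (volume.restrict (Ici (0 : ℝ))) :=
    memLp_top_of_bound hw.aestronglyMeasurable c (ae_of_all _ hc)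
  refine ⟨hmem.toLp w, ?_, hmem.coeFn_toLp⟩
  have hc0 : 0 ≤ c := (norm_nonneg _).trans (hc 0)
  rw [Lp.norm_toLp, eLpNorm_exponent_top]
  exact ENNReal.toReal_le_of_le_ofReal hc0 (eLpNormEssSup_le_of_ae_bound (ae_of_all _ hc))

end Inputs

/-! ### Uniform hitting times of a forward complete system -/

namespace ODESystem

variable {n m : ℕ} {Y : Type*} [NormedAddCommGroup Y] {S : ODESystem n m Y}

theorem isCaratheodoryOn_of_isSolution {x : EuclideanSpace ℝ (Fin n)} {u : InputSpace m}
    {ξ : ℝ → EuclideanSpace ℝ (Fin n)} (hξ : S.IsSolution x u ξ)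
    {w : ℝ → EuclideanSpace ℝ (Fin m)} (hw : u =ᵐ[volume.restrict (Ici (0 : ℝ))] w) (T : ℝ) :
    IsCaratheodoryOn S.f w x ξ T := by
  have h : IsCaratheodoryOn S.f u x ξ T := fun t ht => hξ t ht.1
  refine h.congr_input ?_
  filter_upwards [(ae_restrict_iff' measurableSet_Ici).1 hw] with s hs hs'
  exact hs hs'.1.le

theorem isSolution_transition (hS : S.ForwardComplete) (x : EuclideanSpace ℝ (Fin n))
    (u : InputSpace m) : S.IsSolution x u fun t => S.transition hS t x u :=
  Classical.choose_spec (hS x u)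

theorem exists_lipschitz_bound (S : ODESystem n m Y) (R c : ℝ) :
    ∃ L, 0 ≤ L ∧ ∀ z z' v, ‖z‖ ≤ R → ‖z'‖ ≤ R → ‖v‖ ≤ c → ‖S.f z v - S.f z' v‖ ≤ L * ‖z - z'‖ := by
  obtain ⟨L, hL, h⟩ := S.lipschitz (|R| + |c| + 1) (by positivity)
  refine ⟨L, hL.le, fun z z' v hz hz' hv => h z ?_ z' ?_ v ?_⟩ <;> rw [mem_ball_zero_iff] <;>
    linarith [le_abs_self R, le_abs_self c, abs_nonneg R, abs_nonneg c]

/-- Forward completeness forces `f(0, ·)` to be bounded on bounded sets: otherwise some bounded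
input `w` satisfies `‖f(0, w(s))‖ ≥ 1 / s` for `s ∈ (0, 1]`, and `f(ξ(s), w(s))`, which differs from
`f(0, w(s))` by a bounded function, is not integrable. -/
theorem ForwardComplete.exists_bound_zero (hS : S.ForwardComplete) (c : ℝ) :
    ∃ M, ∀ v, ‖v‖ ≤ c → ‖S.f 0 v‖ ≤ M := by
  by_contra! hcon
  choose v hvc hv using fun k : ℕ => hcon (k + 1)
  have hwm : Measurable fun s : ℝ => v ⌊s⁻¹⌋₊ :=
    (measurable_from_top (f := v)).comp (Nat.measurable_floor.comp measurable_inv)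
  obtain ⟨u, -, hu⟩ := exists_inputSpace_of_norm_le hwm fun s => hvc _
  obtain ⟨ξ, hξ⟩ := hS 0 u
  have hsol := isCaratheodoryOn_of_isSolution hξ hu 1
  obtain ⟨R, hR⟩ := isCompact_Icc.exists_bound_of_continuousOn hsol.continuousOn
  have hR0 : 0 ≤ R := (norm_nonneg _).trans (hR 0 ⟨le_rfl, zero_le_one⟩)
  obtain ⟨L, hL, hlip⟩ := S.exists_lipschitz_bound R c
  have hint := ((hsol 1 ⟨zero_le_one, le_rfl⟩).1.norm.add
    (intervalIntegrable_const (c := L * R)))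
  have hinv : IntervalIntegrable (fun s : ℝ => s⁻¹) volume 0 1 := by
    refine hint.mono_fun' measurable_inv.aestronglyMeasurable ?_
    rw [Filter.EventuallyLE, ae_restrict_iff' measurableSet_uIoc]
    refine ae_of_all _ fun s hs => ?_
    rw [uIoc_of_le zero_le_one] at hs
    have h1 := hlip 0 (ξ s) (v ⌊s⁻¹⌋₊) (by simpa using hR0) (hR s ⟨hs.1.le, hs.2⟩) (hvc _)
    have h2 : ‖(0 : EuclideanSpace ℝ (Fin n)) - ξ s‖ ≤ R := by
      simpa using hR s ⟨hs.1.le, hs.2⟩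
    have h3 := norm_le_norm_add_norm_sub' (S.f 0 (v ⌊s⁻¹⌋₊)) (S.f (ξ s) (v ⌊s⁻¹⌋₊))
    have h4 := mul_le_mul_of_nonneg_left h2 hL
    have h5 := hv ⌊s⁻¹⌋₊
    have h6 := Nat.lt_floor_add_one s⁻¹
    rw [Real.norm_of_nonneg (inv_nonneg.2 hs.1.le)]
    change s⁻¹ ≤ ‖S.f (ξ s) (v ⌊s⁻¹⌋₊)‖ + L * R
    linarith
  rw [intervalIntegrable_inv_iff] at hinv
  simp at hinv

theorem ForwardComplete.exists_isStepTime (hS : S.ForwardComplete) (c R : ℝ) :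
    ∃ H, IsStepTime S.f c R H := by
  obtain ⟨M, hM⟩ := hS.exists_bound_zero c
  obtain ⟨L', hL', hlip'⟩ := S.exists_lipschitz_bound (|R| + 1) c
  obtain ⟨L, hL, hlip⟩ := S.exists_lipschitz_bound (R + 1) c
  refine _root_.exists_isStepTime (M := M + L' * (|R| + 1)) (fun z v hz hv => ?_) hL hlip
  have hz' : ‖z‖ ≤ |R| + 1 := hz.trans (by linarith [le_abs_self R])
  have h1 := hlip' z 0 v hz' (by simpa using by positivity) hv
  rw [sub_zero] at h1
  have h2 := norm_le_norm_add_norm_sub' (S.f z v) (S.f 0 v)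
  linarith [hM v hv, mul_le_mul_of_nonneg_left hz' hL']

theorem ForwardComplete.exists_uniform_hitting_time (hS : S.ForwardComplete) {c a a' : ℝ}
    (ha : a' < a)
    (hhit : ∀ x u, ‖u‖ ≤ c → ∃ t, 0 ≤ t ∧ ‖S.output hS t x u‖ ≤ a') (r : ℝ) :
    ∃ τ : ℝ, 0 ≤ τ ∧ ∀ x ∈ ball (0 : EuclideanSpace ℝ (Fin n)) r, ∀ u : InputSpace m, ‖u‖ ≤ c →
      ∃ t, 0 ≤ t ∧ t ≤ τ ∧ ‖S.output hS t x u‖ ≤ a := by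
  have hfc : ∀ x w, Measurable w → (∀ s, ‖w s‖ ≤ c) →
      ∃ u : InputSpace m, ‖u‖ ≤ c ∧
        ∀ T, IsCaratheodoryOn S.f w x (fun t => S.transition hS t x u) T := by
    intro x w hwm hwc
    obtain ⟨u, huc, hu⟩ := exists_inputSpace_of_norm_le hwm hwc
    exact ⟨u, huc, isCaratheodoryOn_of_isSolution (isSolution_transition hS x u) hu⟩
  obtain ⟨τ, hτ0, hτ⟩ := _root_.exists_uniform_hitting_time S.continuous_h
    (hS.exists_isStepTime c)
    (fun x w hwm hwc => let ⟨_, _, h⟩ := hfc x w hwm hwc; ⟨_, h⟩) ha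
    (fun x w hwm hwc => let ⟨u, huc, h⟩ := hfc x w hwm hwc; ⟨_, h, hhit x u huc⟩) r
  refine ⟨τ, hτ0, fun x hx u huc => ?_⟩
  obtain ⟨w, hwm, hwc, hw⟩ := InputSpace.exists_measurable_representative u
  exact hτ x hx w hwm (fun s => (hwc s).trans huc) _
    (isCaratheodoryOn_of_isSolution (isSolution_transition hS x u) hw)

/-- A uniform hitting time for all inputs of norm at most `ρ`, when the threshold depends on the
norm of the input. It is obtained from `ForwardComplete.exists_uniform_hitting_time` on each of
finitely many intervals of input norms on which `γ` varies by less than `ε / 2`. -/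
theorem ForwardComplete.exists_uniform_limit_time (hS : S.ForwardComplete) {γ : ℝ≥0 → ℝ≥0}
    (hγ : IsClassKInfty γ)
    (hlim : ∀ ε : ℝ, 0 < ε → ∀ x (u : InputSpace m),
      ∃ t : ℝ, 0 ≤ t ∧ ‖S.output hS t x u‖ ≤ ε + (γ ‖u‖₊ : ℝ))
    {ε : ℝ} (hε : 0 < ε) (r : ℝ) (ρ : ℝ≥0) :
    ∃ τ : ℝ, 0 ≤ τ ∧ ∀ x ∈ ball (0 : EuclideanSpace ℝ (Fin n)) r, ∀ u : InputSpace m,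
      ‖u‖₊ ∈ Icc 0 ρ → ∃ t, 0 ≤ t ∧ t ≤ τ ∧ ‖S.output hS t x u‖ ≤ ε + (γ ‖u‖₊ : ℝ) := by
  refine (isCompact_Icc (a := (0 : ℝ≥0)) (b := ρ)).induction_on
    (p := fun s => ∃ τ : ℝ, 0 ≤ τ ∧ ∀ x ∈ ball (0 : EuclideanSpace ℝ (Fin n)) r,
      ∀ u : InputSpace m, ‖u‖₊ ∈ s →
        ∃ t, 0 ≤ t ∧ t ≤ τ ∧ ‖S.output hS t x u‖ ≤ ε + (γ ‖u‖₊ : ℝ))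
    ⟨0, le_rfl, by simp⟩ ?_ ?_ ?_
  · rintro s s' hss' ⟨τ, hτ, h⟩
    exact ⟨τ, hτ, fun x hx u hu => h x hx u (hss' hu)⟩
  · rintro s s' ⟨τ, hτ, h⟩ ⟨τ', hτ', h'⟩
    refine ⟨max τ τ', le_max_of_le_left hτ, fun x hx u hu => ?_⟩
    rcases hu with hu | hu
    · obtain ⟨t, h0, h1, h2⟩ := h x hx u hu
      exact ⟨t, h0, le_max_of_le_left h1, h2⟩
    · obtain ⟨t, h0, h1, h2⟩ := h' x hx u hu
      exact ⟨t, h0, le_max_of_le_right h1, h2⟩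
  · intro c _
    have hγc : Continuous fun q => (γ q : ℝ) := NNReal.continuous_coe.comp hγ.continuous
    have hup : ∀ᶠ q in 𝓝 c, (γ q : ℝ) < γ c + ε / 4 :=
      hγc.continuousAt.eventually_lt_const (by linarith)
    have hlow : ∀ᶠ q in 𝓝 c, (γ c : ℝ) - ε / 4 < γ q :=
      hγc.continuousAt.eventually_const_lt (by linarith)
    obtain ⟨c', hc', hcc'⟩ : ∃ c', (γ c' : ℝ) < γ c + ε / 4 ∧ c < c' :=
      ((hup.filter_mono nhdsWithin_le_nhds).and (self_mem_nhdsWithin (s := Ioi c))).exists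
    obtain ⟨τ, hτ, h⟩ := hS.exists_uniform_hitting_time (c := c') (a := ε / 2 + γ c')
      (a' := ε / 4 + γ c') (by linarith) (fun x u hu => by
        obtain ⟨t, ht, hle⟩ := hlim (ε / 4) (by positivity) x u
        have : (γ ‖u‖₊ : ℝ) ≤ γ c' := by
          exact_mod_cast hγ.strictMono.monotone (show ‖u‖₊ ≤ c' from hu)
        exact ⟨t, ht, by linarith⟩) r
    refine ⟨_, mem_nhdsWithin_of_mem_nhds (hlow.and (eventually_lt_nhds hcc')), τ, hτ,
      fun x hx u hu => ?_⟩
    obtain ⟨t, h0, h1, h2⟩ := h x hx u hu.2.le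
    exact ⟨t, h0, h1, by linarith [hu.1]⟩

end ODESystem

/-! ### The limit properties -/

theorem IsOGULIM.isOULIM {X 𝒰 Y : Type*} [NormedAddCommGroup X] [NormedAddCommGroup 𝒰]
    [NormedAddCommGroup Y] {y : ℝ → X → 𝒰 → Y} (h : IsOGULIM y) : IsOULIM y := by
  obtain ⟨γ, hγ, h⟩ := h
  refine ⟨γ, hγ, fun ε r s hε hr _ => ?_⟩
  obtain ⟨τ, hτ, h⟩ := h ε r hε hr
  exact ⟨τ, hτ, fun x hx u _ => h x hx u⟩

theorem IsOULIM.isOLIM {X 𝒰 Y : Type*} [NormedAddCommGroup X] [NormedAddCommGroup 𝒰]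
    [NormedAddCommGroup Y] {y : ℝ → X → 𝒰 → Y} (h : IsOULIM y) : IsOLIM y := by
  obtain ⟨γ, hγ, h⟩ := h
  refine ⟨γ, hγ, fun ε hε x u => ?_⟩
  obtain ⟨τ, -, h⟩ := h ε (‖x‖ + 1) (‖u‖ + 1) hε (by positivity) (by positivity)
  obtain ⟨t, h0, -, h1⟩ := h x (by simp) u (by simp)
  exact ⟨t, h0, h1⟩

/-- A class `𝒦_∞` gain that dominates `‖h‖` on the balls of radius at least `1`. For radii tending
to `0` this is impossible when `h 0 ≠ 0`. -/
theorem IsClassKInfty.exists_le_and_norm_le {E Y : Type*} [NormedAddCommGroup E] [NormedSpace ℝ E]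
    [ProperSpace E] [NormedAddCommGroup Y] {h : E → Y} (hh : Continuous h) {γ : ℝ≥0 → ℝ≥0}
    (hγ : IsClassKInfty γ) :
    ∃ γ' : ℝ≥0 → ℝ≥0, IsClassKInfty γ' ∧ (∀ q, γ q ≤ γ' q) ∧
      ∀ q : ℝ≥0, 1 ≤ q → ∀ x : E, ‖x‖ ≤ q → ‖h x‖₊ ≤ γ' q := by
  -- `σ q` is the maximum of `‖h‖` over the ball of radius `q`
  let σ : ℝ≥0 → ℝ≥0 := fun q => sSup ((fun x : E => ‖h ((q : ℝ) • x)‖₊) '' closedBall 0 1)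
  have hσc : Continuous σ :=
    (isCompact_closedBall (0 : E) 1).continuous_sSup
      (f := fun (q : ℝ≥0) (x : E) => ‖h ((q : ℝ) • x)‖₊)
      (hh.comp ((NNReal.continuous_coe.comp continuous_fst).smul continuous_snd)).nnnorm
  have hbdd : ∀ q : ℝ≥0,
      BddAbove ((fun x : E => ‖h ((q : ℝ) • x)‖₊) '' closedBall 0 1) := fun q =>
    ((isCompact_closedBall (0 : E) 1).image
      (hh.comp (continuous_const_smul (q : ℝ))).nnnorm).bddAbove
  have hσ : ∀ (q : ℝ≥0) (x : E), ‖x‖ ≤ q → ‖h x‖₊ ≤ σ q := by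
    intro q x hx
    refine le_csSup (hbdd q) ⟨(q : ℝ)⁻¹ • x, ?_, ?_⟩
    · rw [mem_closedBall_zero_iff, norm_smul, norm_inv, Real.norm_of_nonneg q.coe_nonneg]
      exact inv_mul_le_one_of_le₀ hx q.2
    · rcases eq_or_ne q 0 with rfl | hq
      · have : x = 0 := by simpa using hx
        simp [this]
      · simp [smul_smul, mul_inv_cancel₀ (NNReal.coe_ne_zero.2 hq)]
  have hσm : Monotone σ := by
    intro q q' hqq'
    refine csSup_le ((nonempty_closedBall.2 zero_le_one).image _) ?_
    rintro _ ⟨x, hx, rfl⟩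
    refine hσ q' _ ?_
    rw [norm_smul, Real.norm_of_nonneg q.coe_nonneg]
    calc (q : ℝ) * ‖x‖ ≤ q * 1 :=
          mul_le_mul_of_nonneg_left (mem_closedBall_zero_iff.1 hx) q.2
      _ ≤ q' := by simpa using hqq'
  refine ⟨fun q => γ q + q * σ q, ⟨by simp [hγ.map_zero], by
    have := hγ.continuous
    fun_prop, hγ.strictMono.add_monotone fun q q' hqq' => mul_le_mul' hqq' (hσm hqq'), ?_⟩,
    fun q => le_self_add, fun q hq x hx => ?_⟩
  · rintro ⟨C, hC⟩
    refine hγ.unbounded ⟨C, ?_⟩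
    rintro _ ⟨q, rfl⟩
    exact le_self_add.trans (hC ⟨q, rfl⟩)
  · calc ‖h x‖₊ ≤ σ q := hσ q x hx
      _ = 1 * σ q := (one_mul _).symm
      _ ≤ q * σ q := mul_le_mul_left hq _
      _ ≤ γ q + q * σ q := le_add_self

theorem ODESystem.ForwardComplete.isOGULIM_of_isOLIM {n m : ℕ} {Y : Type*} [NormedAddCommGroup Y]
    {S : ODESystem n m Y} (hS : S.ForwardComplete) (h : IsOLIM (S.output hS)) :
    IsOGULIM (S.output hS) := by
  obtain ⟨γ, hγ, hlim⟩ := h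
  obtain ⟨γ', hγ', hle, hout⟩ := hγ.exists_le_and_norm_le S.continuous_h
  refine ⟨γ', hγ', fun ε r hε hr => ?_⟩
  obtain ⟨τ, hτ, h⟩ := hS.exists_uniform_limit_time hγ hlim hε r (max r.toNNReal 1)
  refine ⟨τ, hτ, fun x hx u => ?_⟩
  rcases le_total ‖u‖₊ (max r.toNNReal 1) with hu | hu
  · obtain ⟨t, h0, h1, h2⟩ := h x hx u ⟨zero_le, hu⟩
    have : (γ ‖u‖₊ : ℝ) ≤ γ' ‖u‖₊ := by exact_mod_cast hle _
    exact ⟨t, h0, h1, by linarith⟩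
  · -- for an input whose norm dominates that of the initial state, time `0` works
    refine ⟨0, le_rfl, hτ, ?_⟩
    have h0 : S.transition hS 0 x u = x := by
      simpa using (isSolution_transition hS x u 0 le_rfl).2
    have hxu : ‖x‖ ≤ (‖u‖₊ : ℝ) := by
      have h1 : ‖x‖ < r := by simpa using hx
      have h2 : (r.toNNReal : ℝ) ≤ ‖u‖₊ := by exact_mod_cast (le_max_left _ _).trans hu
      linarith [Real.le_coe_toNNReal r]
    have h3 : (‖S.h x‖₊ : ℝ) ≤ γ' ‖u‖₊ := by
      exact_mod_cast hout _ ((le_max_right _ _).trans hu) x hxu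
    rw [ODESystem.output, h0]
    rw [coe_nnnorm] at h3
    linarith

theorem mainTheorem8 {n m : ℕ} {Y : Type*} [NormedAddCommGroup Y] [NormedSpace ℝ Y]
    (S : ODESystem n m Y) (hS : S.ForwardComplete) :
    List.TFAE [IsOGULIM (S.output hS), IsOULIM (S.output hS), IsOLIM (S.output hS)] := by
  tfae_have 1 → 2 := IsOGULIM.isOULIM
  tfae_have 2 → 3 := IsOULIM.isOLIM
  tfae_have 3 → 1 := hS.isOGULIM_of_isOLIM
  tfae_finish
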